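/- Let $n\ge 1$ and let $T^n=S^1\times\cdots\times S^1$ be the $n$-torus with its global angular coordinates $(\theta_1,\dots,\theta_n)$. A smooth flow $\phi:\mathbb R\times T^n\to T^n$ is generated by the vector field $X(p)=\frac{d}{dt}\phi(t,p)\big|_{t=0}$. It is called quasiperiodic if there are a $C^\infty$ diffeomorphism $V$ of $T^n$ and a smooth flow generated by a constant vector field $Y=\sum_{i=1}^n b_i\,\partial/\partial\theta_i$, with $b_1,\dots,b_n\in\mathbb R$ linearly independent over $\mathbb Q$, such that $V_*X=Y$. The multiplier group of $\phi$ is the subgroup $$\rho_\phi(S_\phi)=\{\alpha\in\mathbb R^*:\ R_*X=\alpha X\ \text{for some } C^\infty \text{ diffeomorphism } R \text{ of } T^n\}$$ of $\mathbb R^*=\mathbb R\setminus\{0\}$, where $R_*X=\mathbf TR\circ X\circ R^{-1}$ is the push-forward of $X$ by $R$. Let $\phi$ be a quasiperiodic flow on $T^n$ generated by a constant vector field $X=\sum_{i=1}^n a_i\,\partial/\partial\theta_i$, $a_i\in\mathbb R$, and let $F\subset\mathbb R$ be a real algebraic number field of degree $n$ over $\mathbb Q$. Suppose that $\phi$ is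 $F$-algebraic, that is, there is a real $\vartheta\neq 0$ such that $\vartheta a_1,\dots,\vartheta a_n$ form a basis of $F$ over $\mathbb Q$. Then $\rho_\phi(S_\phi)$ is a subgroup of the group of units $\mathfrak o_F^*$ of the ring of integers $\mathfrak o_F$ of $F$ (as subgroups of $\mathbb R^*$). -/

import Mathlib

noncomputable section

open scoped Manifold ContDiff

namespace QuasiperiodicFlow

/-- The `n`-torus `S¹ × ⋯ × S¹`. -/
abbrev Torus (n : ℕ) : Type := Fin n → Circle

/-- The model with corners of the product manifold structure on the torus: the product of the
models of the factors `S¹`. -/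
abbrev torusModel (n : ℕ) :
    ModelWithCorners ℝ (Fin n → EuclideanSpace ℝ (Fin 1))
      (ModelPi fun _ : Fin n => EuclideanSpace ℝ (Fin 1)) :=
  ModelWithCorners.pi fun _ : Fin n => 𝓡 1

/-- The (smooth) diffeomorphisms of the torus. -/
abbrev TorusDiffeo (n : ℕ) : Type :=
  Diffeomorph (torusModel n) (torusModel n) (Torus n) (Torus n) ∞

/-- Vector fields on the torus. -/
abbrev TorusVectorField (n : ℕ) : Type :=
  (p : Torus n) → TangentSpace (torusModel n) p

/-- The coordinate vector field `∂/∂θᵢ` for the global angular coordinates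
`p = (exp (i θ₁), …, exp (i θₙ))`: at `p` it is the velocity at `t = 0` of the curve that moves
the `i`-th angle of `p` with unit speed and fixes the other ones. -/
def coordField {n : ℕ} (i : Fin n) : TorusVectorField n := fun p =>
  mfderiv 𝓘(ℝ, ℝ) (torusModel n)
    (fun t : ℝ => (Function.update p i (p i * Circle.exp t) : Torus n)) 0 (1 : ℝ)

/-- The constant vector field `∑ aᵢ ∂/∂θᵢ`. -/
def constField {n : ℕ} (a : Fin n → ℝ) : TorusVectorField n := fun p =>
  ∑ i, a i • (coordField i p : TangentSpace (torusModel n) p)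

/-- The push-forward `R_* X = TR ∘ X ∘ R⁻¹` of a vector field by a diffeomorphism. -/
def pushforward {n : ℕ} (R : TorusDiffeo n) (X : TorusVectorField n) : TorusVectorField n := fun p =>
  mfderiv (torusModel n) (torusModel n) R (R.symm p) (X (R.symm p))

/-- A smooth (complete) flow `φ : ℝ × Tⁿ → Tⁿ`. -/
structure SmoothFlow (n : ℕ) where
  toFun : ℝ → Torus n → Torus n
  smooth : ContMDiff (𝓘(ℝ, ℝ).prod (torusModel n)) (torusModel n) ∞
    (fun x : ℝ × Torus n => toFun x.1 x.2)
  map_zero : ∀ p, toFun 0 p = p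
  map_add : ∀ s t p, toFun (s + t) p = toFun s (toFun t p)

/-- The vector field `X(p) = d/dt φ(t, p)` at `t = 0` that generates the flow `φ`. -/
def SmoothFlow.generator {n : ℕ} (φ : SmoothFlow n) : TorusVectorField n := fun p =>
  mfderiv 𝓘(ℝ, ℝ) (torusModel n) (fun t : ℝ => φ.toFun t p) 0 (1 : ℝ)

/-- `R` is a generalized symmetry of `φ` with multiplier `α`: `R_* X = α X`. -/
def SmoothFlow.IsMultiplier {n : ℕ} (φ : SmoothFlow n) (R : TorusDiffeo n) (α : ℝˣ) : Prop :=
  ∀ p, pushforward R φ.generator p = (α : ℝ) • φ.generator p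

/-- Smooth conjugacy of flows: `V_* X = Y` for some diffeomorphism `V`. -/
def SmoothFlow.SmoothlyConjugate {n : ℕ} (φ ψ : SmoothFlow n) : Prop :=
  ∃ V : TorusDiffeo n, ∀ p, pushforward V φ.generator p = ψ.generator p

/-- A flow is quasiperiodic if it is smoothly conjugate with a flow generated by a constant vector
field whose components are linearly independent over `ℚ`. -/
def SmoothFlow.IsQuasiperiodic {n : ℕ} (φ : SmoothFlow n) : Prop :=
  ∃ (ψ : SmoothFlow n) (b : Fin n → ℝ),
    LinearIndependent ℚ b ∧ ψ.generator = constField b ∧ φ.SmoothlyConjugate ψ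

theorem isMultiplier_iff {n : ℕ} (φ : SmoothFlow n) (R : TorusDiffeo n) (α : ℝˣ) :
    φ.IsMultiplier R α ↔ ∀ p, mfderiv (torusModel n) (torusModel n) R p (φ.generator p) =
      (α : ℝ) • φ.generator (R p) := by
  constructor
  · intro h p
    have := h (R p)
    unfold pushforward at this
    rwa [R.symm_apply_apply] at this
  · intro h p
    have := h (R.symm p)
    rw [R.apply_symm_apply] at this
    exact this

theorem isMultiplier_refl {n : ℕ} (φ : SmoothFlow n) :
    φ.IsMultiplier (Diffeomorph.refl (torusModel n) (Torus n) ∞) 1 := by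
  rw [isMultiplier_iff]
  intro p
  have h : mfderiv (torusModel n) (torusModel n)
      (Diffeomorph.refl (torusModel n) (Torus n) ∞) p
        = ContinuousLinearMap.id ℝ (TangentSpace (torusModel n) p) := mfderiv_id
  rw [h, Units.val_one]
  exact (one_smul ℝ (φ.generator p)).symm

theorem isMultiplier_trans {n : ℕ} {φ : SmoothFlow n} {R S : TorusDiffeo n} {α β : ℝˣ}
    (hR : φ.IsMultiplier R α) (hS : φ.IsMultiplier S β) :
    φ.IsMultiplier (S.trans R) (α * β) := by
  rw [isMultiplier_iff] at *
  intro p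
  have h : mfderiv (torusModel n) (torusModel n) (S.trans R) p (φ.generator p)
      = mfderiv (torusModel n) (torusModel n) R (S p)
        (mfderiv (torusModel n) (torusModel n) S p (φ.generator p)) :=
    congrArg (fun L => L (φ.generator p)) (mfderiv_comp p
      (R.mdifferentiable (by simp) (S p)) (S.mdifferentiable (by simp) p))
  refine h.trans ?_
  rw [hS p, map_smul, hR (S p), smul_smul, Units.val_mul, mul_comm]
  rfl

theorem isMultiplier_symm {n : ℕ} {φ : SmoothFlow n} {R : TorusDiffeo n} {α : ℝˣ}
    (hR : φ.IsMultiplier R α) : φ.IsMultiplier R.symm α⁻¹ := by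
  rw [isMultiplier_iff]
  intro p
  obtain ⟨q, rfl⟩ : ∃ q, R q = p := ⟨R.symm p, R.apply_symm_apply p⟩
  have h : mfderiv (torusModel n) (torusModel n) R.symm (R q)
      (mfderiv (torusModel n) (torusModel n) R q (φ.generator q)) = φ.generator q := by
    have h1 := mfderiv_comp q (R.symm.mdifferentiable (by simp) (R q))
      (R.mdifferentiable (by simp) q)
    have h2 : (R.symm ∘ R : Torus n → Torus n) = id := funext R.symm_apply_apply
    rw [h2, mfderiv_id] at h1
    exact (congrArg (fun L => L (φ.generator q)) h1).symm
  rw [(isMultiplier_iff φ R α).1 hR q, map_smul] at h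
  have key : ∀ u v : Fin n → EuclideanSpace ℝ (Fin 1),
      (α : ℝ) • u = v → u = ((α⁻¹ : ℝˣ) : ℝ) • v := by
    rintro u v rfl
    rw [smul_smul, Units.inv_mul, one_smul]
  rw [R.symm_apply_apply]
  exact key _ _ h

/-- The multiplier group of a flow: the multipliers of its generalized symmetries, as a subgroup of
the multiplicative group of the real numbers. -/
def SmoothFlow.multiplierGroup {n : ℕ} (φ : SmoothFlow n) : Subgroup ℝˣ where
  carrier := {α | ∃ R : TorusDiffeo n, φ.IsMultiplier R α}
  mul_mem' := by
    rintro α β ⟨R, hR⟩ ⟨S, hS⟩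
    exact ⟨S.trans R, isMultiplier_trans hR hS⟩
  one_mem' := ⟨_, isMultiplier_refl φ⟩
  inv_mem' := by
    rintro α ⟨R, hR⟩
    exact ⟨R.symm, isMultiplier_symm hR⟩

/-- The constant vector field `∑ aᵢ ∂/∂θᵢ` is `F`-algebraic, for a subfield `F` of `ℝ`, if for some
nonzero real `ϑ` the numbers `ϑ a₁, …, ϑ aₙ` form a basis of `F` over `ℚ`. (Then `F` is a number
field of degree `n`.) -/
def IsAlgebraicOver {n : ℕ} (a : Fin n → ℝ) (F : IntermediateField ℚ ℝ) : Prop :=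
  ∃ ϑ : ℝ, ϑ ≠ 0 ∧ ∃ b : Module.Basis (Fin n) ℚ F, ∀ i, (b i : ℝ) = ϑ * a i

/-- The group of units of the ring of integers of a subfield `F` of `ℝ`, as a subgroup of the
multiplicative group of the real numbers. -/
def unitGroup (F : IntermediateField ℚ ℝ) : Subgroup ℝˣ :=
  (Units.map ((algebraMap F ℝ).comp
    (algebraMap (NumberField.RingOfIntegers F) F)).toMonoidHom).range

end QuasiperiodicFlow

end

open scoped Manifold ContDiff

namespace QuasiperiodicFlow

/-! If `R_* X = α X` with `X` constant, then `R` carries the orbit `t ↦ exp(t a)` of the identity to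
a curve whose `j`-th coordinate rotates at speed `α aⱼ`. Lifted to the universal cover, this
coordinate of `R` is an integral linear form `m` (its degrees around the factors) plus a periodic,
hence bounded, function. Comparing growth along `t a` gives `α aⱼ = ∑ mᵢ aᵢ`
(`exists_int_combination`).

So `α` preserves the lattice spanned by the `aᵢ`. Rescaled by `ϑ`, this is a full lattice in `F`, so
`α` lies in `F` and is integral (`exists_ringOfIntegers_of_int_combination`). Multipliers form a
group, so `α⁻¹` is integral too and `α` is a unit. -/

/-! ### Topology: lifts to the universal cover -/

/-- Two continuous real-valued angle functions on a connected space that describe the same point of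
the circle everywhere agree as soon as they agree somewhere. -/
theorem eq_of_circleExp_eq {X : Type*} [TopologicalSpace X] [PreconnectedSpace X] {f g : X → ℝ}
    (hf : Continuous f) (hg : Continuous g) (h : ∀ x, Circle.exp (f x) = Circle.exp (g x))
    (x₀ : X) (h₀ : f x₀ = g x₀) (x : X) : f x = g x :=
  congrFun (Circle.isCoveringMap_exp.eq_of_comp_eq hf hg (funext h) x₀ h₀) x

/-- A continuous function on `ℝⁿ` that is periodic in every coordinate is bounded. -/
theorem exists_bound_of_periodic {n : ℕ} {s : (Fin n → ℝ) → ℝ} (hs : Continuous s) {T : ℝ}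
    (hT : 0 < T) (hper : ∀ i, Function.Periodic s (Pi.single i T)) : ∃ C, ∀ x, |s x| ≤ C := by
  obtain ⟨C, hC⟩ := (isCompact_Icc (a := (0 : Fin n → ℝ))
    (b := fun _ => T)).exists_bound_of_continuousOn hs.continuousOn
  refine ⟨C, fun x => ?_⟩
  -- Translating by this period moves `x` into the cube `[0, T]ⁿ`.
  have hsum : Function.Periodic s (∑ i, (-⌊x i / T⌋) • Pi.single i T) :=
    Finset.sum_induction _ (Function.Periodic s) (fun _ _ => Function.Periodic.add_period)
      (fun y => by rw [add_zero]) fun i _ => (hper i).zsmul _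
  rw [← hsum x]
  refine hC _ ?_
  have key : ∀ i, (x + ∑ j, (-⌊x j / T⌋) • (Pi.single j T : Fin n → ℝ)) i
      = T * Int.fract (x i / T) := by
    intro i
    rw [Pi.add_apply, Finset.sum_apply, Finset.sum_eq_single i]
    · simp only [Pi.smul_apply, Pi.single_eq_same, zsmul_eq_mul, Int.fract]
      push_cast
      field_simp
      ring
    · intro j _ hj
      simp [Pi.single_eq_of_ne hj.symm]
    · simp
  refine ⟨fun i => ?_, fun i => ?_⟩
  · rw [key]
    exact mul_nonneg hT.le (Int.fract_nonneg _)
  · rw [key]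
    exact mul_le_of_le_one_right hT.le (Int.fract_lt_one _).le

/-- If a continuous map from the torus to the circle is a rotation at speed `β` along the
one-parameter subgroup with velocity `a`, then `β` is an integral combination of the `aᵢ`. -/
theorem exists_int_combination {n : ℕ} {g : Torus n → Circle} (hg : Continuous g)
    {a : Fin n → ℝ} {β : ℝ}
    (h : ∀ t : ℝ, g (fun i => Circle.exp (t * a i)) = g 1 * Circle.exp (t * β)) :
    ∃ m : Fin n → ℤ, β = ∑ i, m i * a i := by
  have hcont : Continuous fun x : Fin n → ℝ => g fun i => Circle.exp (x i) :=
    hg.comp (continuous_pi fun i => Circle.exp.continuous.comp (continuous_apply i))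
  obtain ⟨e₀, he₀⟩ := Circle.isAddQuotientCoveringMap_exp.surjective
    (g fun i => Circle.exp ((0 : Fin n → ℝ) i))
  obtain ⟨r, ⟨-, hr⟩, -⟩ := Circle.isCoveringMap_exp.existsUnique_continuousMap_lifts
    ⟨_, hcont⟩ (0 : Fin n → ℝ) e₀ he₀
  have hr' : ∀ x, Circle.exp (r x) = g fun i => Circle.exp (x i) := congrFun hr
  have hshift : ∀ i x, Circle.exp (r (x + Pi.single i (2 * Real.pi))) = Circle.exp (r x) := by
    intro i x
    rw [hr', hr']
    congr 1
    ext1 j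
    by_cases hj : j = i
    · subst hj
      simp
    · simp [Pi.single_eq_of_ne hj]
  have hm : ∀ i, ∃ m : ℤ, r (0 + Pi.single i (2 * Real.pi)) = r 0 + m * (2 * Real.pi) :=
    fun i => Circle.exp_eq_exp.1 (hshift i 0)
  choose m hm using hm
  -- Both sides lift the same circle-valued map, so the integer found at `0` serves at every `x`.
  have hper : ∀ i x, r (x + Pi.single i (2 * Real.pi)) = r x + m i * (2 * Real.pi) := by
    intro i
    refine eq_of_circleExp_eq (by fun_prop) (by fun_prop) (fun x => ?_) 0 (hm i)
    rw [hshift, Circle.exp_eq_exp]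
    exact ⟨-m i, by push_cast; ring⟩
  have hline : ∀ t : ℝ, r (t • a) = r 0 + t * β := by
    refine eq_of_circleExp_eq (by fun_prop) (by fun_prop) (fun t => ?_) 0 (by simp)
    rw [Circle.exp_add, hr', hr']
    simp only [Pi.smul_apply, smul_eq_mul, h]
    congr 2
    ext1 i
    simp
  -- Subtracting the linear form given by the degrees `m i` leaves a periodic function.
  obtain ⟨C, hC⟩ := exists_bound_of_periodic (s := fun x => r x - ∑ i, m i * x i) (by fun_prop)
    Real.two_pi_pos (fun i x => by
      simp only [hper, Pi.add_apply, mul_add, Finset.sum_add_distrib, Pi.single_apply, mul_ite,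
        mul_zero, Finset.sum_ite_eq', Finset.mem_univ, if_true]
      ring)
  refine ⟨m, ?_⟩
  by_contra hne
  have hδ : 0 < |β - ∑ i, m i * a i| := abs_pos.2 (sub_ne_zero.2 hne)
  have hlin : ∀ t : ℝ, |t| * |β - ∑ i, m i * a i| ≤ C + |r 0| := by
    intro t
    have h1 := hC (t • a)
    have h2 : t * (β - ∑ i, m i * a i) = (r (t • a) - ∑ i, m i * (t • a) i) - r 0 := by
      rw [hline, mul_sub, Finset.mul_sum]
      simp only [Pi.smul_apply, smul_eq_mul, mul_left_comm]
      ring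
    rw [← abs_mul, h2]
    exact (abs_sub _ _).trans (by gcongr)
  have hC0 : 0 ≤ C + |r 0| := by simpa using hlin 0
  have := hlin ((C + |r 0| + 1) / |β - ∑ i, m i * a i|)
  rw [abs_of_nonneg (by positivity), div_mul_cancel₀ _ hδ.ne'] at this
  linarith

/-- Solutions of `z' = iβz` are rotations at speed `β`. -/
theorem eq_mul_exp_of_hasDerivAt {z : ℝ → ℂ} {β : ℝ}
    (hz : ∀ t, HasDerivAt z (β * (Complex.I * z t)) t) (t : ℝ) :
    z t = z 0 * Circle.exp (t * β) := by
  -- Integrating factor: `z` times this exponential has zero derivative.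
  have hexp : ∀ s : ℝ, HasDerivAt (fun u : ℝ => Complex.exp (-(u * β * Complex.I)))
      (Complex.exp (-(s * β * Complex.I)) * -(1 * β * Complex.I)) s := fun s =>
    ((((hasDerivAt_id (s : ℂ)).comp_ofReal.mul_const (β : ℂ)).mul_const Complex.I).neg).cexp
  have hderiv : ∀ s, HasDerivAt (fun u : ℝ => z u * Complex.exp (-(u * β * Complex.I))) 0 s := by
    intro s
    refine ((hz s).mul (hexp s)).congr_deriv ?_
    ring
  have hconst := is_const_of_deriv_eq_zero (fun s => (hderiv s).differentiableAt)
    (fun s => (hderiv s).deriv) t 0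
  simp only [Complex.ofReal_zero, zero_mul, neg_zero, Complex.exp_zero, mul_one] at hconst
  rw [← hconst, Circle.coe_exp, mul_assoc, ← Complex.exp_add]
  simp

/-! ### Algebra: integrality of lattice-preserving numbers -/

/-- A real number that maps the lattice spanned by `a` into itself, where a multiple of `a` is a
basis of `F`, is the image of an algebraic integer of `F`. -/
theorem exists_ringOfIntegers_of_int_combination {n : ℕ} {a : Fin n → ℝ}
    {F : IntermediateField ℚ ℝ} (hF : IsAlgebraicOver a F) {α : ℝ}
    (h : ∀ j, ∃ m : Fin n → ℤ, α * a j = ∑ i, m i * a i) :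
    ∃ x : NumberField.RingOfIntegers F, ((x : F) : ℝ) = α := by
  obtain ⟨ϑ, hϑ, b, hb⟩ := hF
  have hα : ∀ j, ∃ m : Fin n → ℤ, α * b j = ((∑ i, m i • b i : F) : ℝ) := by
    intro j
    obtain ⟨m, hm⟩ := h j
    refine ⟨m, ?_⟩
    have hsum : ((∑ i, m i • b i : F) : ℝ) = ∑ i, m i * (ϑ * a i) := by
      simp [← hb]
    rw [hsum, hb, mul_left_comm, hm, Finset.mul_sum]
    exact Finset.sum_congr rfl fun i _ => mul_left_comm _ _ _
  obtain ⟨j⟩ := b.index_nonempty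
  have hbj : ((b j : F) : ℝ) ≠ 0 := fun h0 => b.ne_zero j (Subtype.ext h0)
  -- `α` is a quotient of two elements of `F`.
  have hmem : α ∈ F := by
    obtain ⟨m, hm⟩ := hα j
    rw [eq_div_of_mul_eq hbj hm]
    exact F.div_mem (Subtype.prop _) (Subtype.prop _)
  have hint : IsIntegral ℤ (⟨α, hmem⟩ : F) := by
    -- The lattice is a nonzero finitely generated `ℤ`-module stable under `α`, which forces
    -- integrality.
    refine isIntegral_of_smul_mem_submodule (Submodule.span ℤ (Set.range b)) ?_
      (Submodule.fg_span (Set.finite_range b)) _ ?_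
    · intro hbot
      have := Submodule.subset_span (R := ℤ) (Set.mem_range_self (f := b) j)
      rw [hbot] at this
      exact b.ne_zero j this
    · intro x hx
      induction hx using Submodule.span_induction with
      | mem x hx =>
        obtain ⟨i, rfl⟩ := hx
        obtain ⟨m, hm⟩ := hα i
        have : (⟨α, hmem⟩ : F) • b i = ∑ k, m k • b k := Subtype.ext hm
        rw [this]
        exact Submodule.sum_mem _ fun k _ =>
          Submodule.smul_mem _ _ (Submodule.subset_span (Set.mem_range_self k))
      | zero => simp
      | add x y _ _ hx hy => rw [smul_add]; exact Submodule.add_mem _ hx hy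
      | smul c x _ hx => rw [smul_comm]; exact Submodule.smul_mem _ _ hx
  exact ⟨⟨_, hint⟩, rfl⟩

/-! ### Calculus on the torus in complex coordinates -/

/-- The coordinate `pⱼ` of a point of the torus, as a complex number. -/
def complexCoord {n : ℕ} (j : Fin n) (p : Torus n) : ℂ := p j

theorem mdifferentiableAt_circleCoe (z : Circle) :
    MDifferentiableAt (𝓡 1) 𝓘(ℝ, ℂ) (fun w : Circle => (w : ℂ)) z := by
  have : Fact (Module.finrank ℝ ℂ = 1 + 1) := finrank_real_complex_fact'
  exact (contMDiff_coe_sphere (m := 1) (E := ℂ) (n := 1)).mdifferentiable (by simp) z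

theorem mdifferentiableAt_complexCoord {n : ℕ} (j : Fin n) (p : Torus n) :
    MDifferentiableAt (torusModel n) 𝓘(ℝ, ℂ) (complexCoord j) p := by
  have h := (mdifferentiableAt_iff _ _).1 (mdifferentiableAt_circleCoe (p j))
  have hcont : Continuous (complexCoord j : Torus n → ℂ) := by
    unfold complexCoord
    fun_prop
  refine (mdifferentiableAt_iff _ _).2 ⟨hcont.continuousAt, ?_⟩
  have hproj : DifferentiableAt ℝ (fun x : Fin n → EuclideanSpace ℝ (Fin 1) => x j)
      (extChartAt (torusModel n) p p) := differentiableAt_pi.1 differentiableAt_id j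
  rw [ModelWithCorners.Boundaryless.range_eq_univ, differentiableWithinAt_univ] at h
  -- In product charts, `complexCoord j` is the `j`-th projection followed by the chart expression
  -- of the inclusion of the circle in `ℂ`.
  exact (DifferentiableAt.comp (extChartAt (torusModel n) p p) h.2 hproj).differentiableWithinAt

theorem mdifferentiableAt_torus_of_coord {n : ℕ} {c : ℝ → Torus n} {t : ℝ}
    (h : ∀ j, MDifferentiableAt 𝓘(ℝ, ℝ) (𝓡 1) (fun s => c s j) t) :
    MDifferentiableAt 𝓘(ℝ, ℝ) (torusModel n) c t := by
  refine (mdifferentiableAt_iff _ _).2 ⟨continuousAt_pi.2 fun j => (h j).continuousAt, ?_⟩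
  refine differentiableWithinAt_pi.2 fun j => ?_
  exact ((mdifferentiableAt_iff _ _).1 (h j)).2

/-- The chain rule turns manifold derivatives into ordinary ones. The point `p` is kept apart from
`c t` so that no rewriting in tangent spaces is needed. -/
theorem hasDerivAt_comp_curve {n : ℕ} {f : Torus n → ℂ} {c : ℝ → Torus n} {t : ℝ} {p : Torus n}
    (hp : c t = p) (hf : MDifferentiableAt (torusModel n) 𝓘(ℝ, ℂ) f p)
    (hc : MDifferentiableAt 𝓘(ℝ, ℝ) (torusModel n) c t) :
    HasDerivAt (fun s => f (c s)) (mfderiv (torusModel n) 𝓘(ℝ, ℂ) f p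
      (mfderiv 𝓘(ℝ, ℝ) (torusModel n) c t (1 : ℝ))) t := by
  subst hp
  let D : ℝ →L[ℝ] ℂ := (mfderiv (torusModel n) 𝓘(ℝ, ℂ) f (c t)).comp
    (mfderiv 𝓘(ℝ, ℝ) (torusModel n) c t)
  have h : HasFDerivAt (fun s => f (c s)) D t :=
    (hf.hasMFDerivAt.comp t hc.hasMFDerivAt).hasFDerivAt
  exact h.hasDerivAt

theorem mfderiv_complexCoord_coordField {n : ℕ} (i j : Fin n) (p : Torus n) :
    mfderiv (torusModel n) 𝓘(ℝ, ℂ) (complexCoord j) p (coordField i p)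
      = if j = i then Complex.I * p j else (0 : ℂ) := by
  have hc : MDifferentiableAt 𝓘(ℝ, ℝ) (torusModel n)
      (fun t : ℝ => (Function.update p i (p i * Circle.exp t) : Torus n)) 0 := by
    refine mdifferentiableAt_torus_of_coord fun k => ?_
    by_cases hk : k = i
    · subst hk
      simp only [Function.update_self]
      exact ((contMDiff_const (c := p k)).mul (contMDiff_circleExp (m := 1))).mdifferentiable
        (by simp) 0
    · simp only [Function.update_of_ne hk]
      exact mdifferentiableAt_const
  have h0 : (Function.update p i (p i * Circle.exp 0) : Torus n) = p := by simp
  have h := hasDerivAt_comp_curve h0 (mdifferentiableAt_complexCoord j p) hc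
  refine h.unique ?_
  unfold complexCoord
  split_ifs with hj
  · subst hj
    have hexp := (((hasDerivAt_id ((0 : ℝ) : ℂ)).comp_ofReal.mul_const Complex.I).cexp).const_mul
      (p j : ℂ)
    simp only [Function.update_self, Circle.coe_mul, Circle.coe_exp]
    refine hexp.congr_deriv ?_
    simp [mul_comm]
  · simp only [Function.update_of_ne hj]
    exact hasDerivAt_const _ _

theorem mfderiv_complexCoord_constField {n : ℕ} (a : Fin n → ℝ) (j : Fin n) (p : Torus n) :
    mfderiv (torusModel n) 𝓘(ℝ, ℂ) (complexCoord j) p (constField a p)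
      = (a j * (Complex.I * p j) : ℂ) := by
  have h : mfderiv (torusModel n) 𝓘(ℝ, ℂ) (complexCoord j) p (constField a p)
      = ∑ i, a i • (if j = i then Complex.I * p j else (0 : ℂ)) := by
    refine (map_sum _ _ _).trans (Finset.sum_congr rfl fun i _ => ?_)
    refine (map_smul _ _ _).trans ?_
    rw [mfderiv_complexCoord_coordField]
    rfl
  rw [h, Finset.sum_congr rfl fun i _ => smul_ite _ _ _ _]
  simp only [smul_zero, Finset.sum_ite_eq, Finset.mem_univ, if_true, Complex.real_smul]
  rfl

/-! ### Orbits of the flow and their images under symmetries -/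

namespace SmoothFlow

theorem mdifferentiableAt_orbit {n : ℕ} (φ : SmoothFlow n) (p : Torus n) (t : ℝ) :
    MDifferentiableAt 𝓘(ℝ, ℝ) (torusModel n) (fun s => φ.toFun s p) t :=
  (φ.smooth.comp (contMDiff_id.prodMk contMDiff_const)).mdifferentiable (by simp) t

/-- The derivative of an observable along an orbit of the flow is its derivative in the direction of
the generator. -/
theorem hasDerivAt_orbit {n : ℕ} (φ : SmoothFlow n) {f : Torus n → ℂ}
    (hf : MDifferentiable (torusModel n) 𝓘(ℝ, ℂ) f) (p : Torus n) (t : ℝ) :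
    HasDerivAt (fun s => f (φ.toFun s p))
      (mfderiv (torusModel n) 𝓘(ℝ, ℂ) f (φ.toFun t p) (φ.generator (φ.toFun t p))) t := by
  have h := hasDerivAt_comp_curve (φ.map_zero _) (hf (φ.toFun t p))
    (φ.mdifferentiableAt_orbit (φ.toFun t p) 0)
  -- Writing time `0` as `t - t` lets the group law carry the derivative to time `t`.
  rw [← sub_self t] at h
  have h' := h.comp_sub_const t t
  simp only [← φ.map_add, sub_add_cancel] at h'
  rw [sub_self] at h'
  exact h'

theorem toFun_eq_mul_exp {n : ℕ} {φ : SmoothFlow n} {a : Fin n → ℝ}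
    (hX : φ.generator = constField a) (p : Torus n) (t : ℝ) (j : Fin n) :
    φ.toFun t p j = p j * Circle.exp (t * a j) := by
  have h := eq_mul_exp_of_hasDerivAt (z := fun s => complexCoord j (φ.toFun s p)) (β := a j)
    (fun s => (φ.hasDerivAt_orbit (mdifferentiableAt_complexCoord j) p s).congr_deriv
      (by rw [hX, mfderiv_complexCoord_constField]; rfl)) t
  rw [φ.map_zero] at h
  exact Circle.ext h

/-- Since `TR ∘ X = α X ∘ R`, the `j`-th coordinate of `R` along an orbit solves `z' = i α aⱼ z`. -/
theorem IsMultiplier.apply_toFun {n : ℕ} {φ : SmoothFlow n} {a : Fin n → ℝ}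
    (hX : φ.generator = constField a) {R : TorusDiffeo n} {α : ℝˣ} (hR : φ.IsMultiplier R α)
    (p : Torus n) (t : ℝ) (j : Fin n) :
    R (φ.toFun t p) j = R p j * Circle.exp (t * (α * a j)) := by
  have hRd : MDifferentiable (torusModel n) (torusModel n) R := R.mdifferentiable (by simp)
  have h := eq_mul_exp_of_hasDerivAt (z := fun s => complexCoord j (R (φ.toFun s p)))
    (β := α * a j) (fun s => by
      refine (φ.hasDerivAt_orbit (f := complexCoord j ∘ R)
        (fun q => (mdifferentiableAt_complexCoord j (R q)).comp q (hRd q)) p s).congr_deriv ?_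
      generalize φ.toFun s p = q
      rw [mfderiv_comp q (mdifferentiableAt_complexCoord j (R q)) (hRd q)]
      refine (congrArg (mfderiv (torusModel n) 𝓘(ℝ, ℂ) (complexCoord j) (R q))
        ((isMultiplier_iff φ R α).1 hR q)).trans ((map_smul _ _ _).trans ?_)
      rw [hX, mfderiv_complexCoord_constField]
      refine (Complex.real_smul).trans ?_
      push_cast
      exact (mul_assoc _ _ _).symm) t
  rw [φ.map_zero] at h
  exact Circle.ext h

/-- The multipliers of a flow with constant generator map the lattice spanned by the frequencies
into itself. -/
theorem exists_int_combination_of_mem_multiplierGroup {n : ℕ} {φ : SmoothFlow n} {a : Fin n → ℝ}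
    (hX : φ.generator = constField a) {α : ℝˣ} (hα : α ∈ φ.multiplierGroup) (j : Fin n) :
    ∃ m : Fin n → ℤ, α * a j = ∑ i, m i * a i := by
  obtain ⟨R, hR⟩ := hα
  refine exists_int_combination (g := fun p => R p j)
    ((continuous_apply j).comp R.continuous) fun t => ?_
  have horbit : φ.toFun t 1 = fun i => Circle.exp (t * a i) := by
    funext i
    rw [toFun_eq_mul_exp hX, Pi.one_apply, one_mul]
  rw [← hR.apply_toFun hX 1 t j, horbit]

end SmoothFlow

end QuasiperiodicFlow

theorem theorem3p4 (n : ℕ) (φ : QuasiperiodicFlow.SmoothFlow n) (hφ : φ.IsQuasiperiodic)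
    (a : Fin n → ℝ) (hX : φ.generator = QuasiperiodicFlow.constField a)
    (F : IntermediateField ℚ ℝ)
    (hF : QuasiperiodicFlow.IsAlgebraicOver a F) :
    φ.multiplierGroup ≤ QuasiperiodicFlow.unitGroup F := by
  intro α hα
  obtain ⟨x, hx⟩ := QuasiperiodicFlow.exists_ringOfIntegers_of_int_combination hF
    (QuasiperiodicFlow.SmoothFlow.exists_int_combination_of_mem_multiplierGroup hX hα)
  obtain ⟨y, hy⟩ := QuasiperiodicFlow.exists_ringOfIntegers_of_int_combination hF
    (QuasiperiodicFlow.SmoothFlow.exists_int_combination_of_mem_multiplierGroup hX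
      (inv_mem hα))
  have hxy : x * y = 1 := by
    apply NumberField.RingOfIntegers.ext
    apply Subtype.ext
    change ((x : F) : ℝ) * ((y : F) : ℝ) = 1
    rw [hx, hy, Units.mul_inv]
  exact ⟨⟨x, y, hxy, mul_comm x y ▸ hxy⟩, Units.ext hx⟩
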